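/- All graphs are finite and undirected, without loops, possibly with multiple edges. A cycle of length $n\ge 2$ consists of $n$ distinct vertices and $n$ distinct edges in a cyclic arrangement, each edge joining consecutive vertices (so a cycle of length $2$ is a pair of parallel edges). A nowhere-zero $k$-flow of a graph $\Gamma$ is a pair $(\mathcal D,\varphi)$, where $\mathcal D$ is an orientation of $\Gamma$ and $\varphi\colon E(\Gamma)\to\mathbb Z$ satisfies $0<|\varphi(e)|<k$ for every edge $e$ and, for every vertex $v$, $$\sum_{e\text{ with tail }v}\varphi(e)=\sum_{e\text{ with head }v}\varphi(e).$$ **Theorem.** If every edge of a graph $\Gamma$ is contained in a cycle of $\Gamma$ of length at most $4$, then $\Gamma$ admits a nowhere-zero $4$-flow. -/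

import Mathlib

namespace Graph

/-- `C.IsCycle n`: the multigraph `C` is a cycle of length `n`, i.e. it consists of `n ≥ 1` distinct
vertices and `n` distinct edges in a cyclic arrangement, the `i`-th edge joining the `i`-th vertex
to the next one. A cycle of length `2` is a pair of parallel edges (and length `1` is a loop). -/
def IsCycle {α β : Type*} (C : Graph α β) (n : ℕ) : Prop :=
  1 ≤ n ∧ ∃ (v : ZMod n → α) (e : ZMod n → β),
    Function.Injective v ∧ Function.Injective e ∧
    C.vertexSet = Set.range v ∧ C.edgeSet = Set.range e ∧
    ∀ i : ZMod n, C.IsLink (e i) (v i) (v (i + 1))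

/-- An orientation of a multigraph: each edge is directed from one of its ends to the other. -/
structure Orientation {α β : Type*} (G : Graph α β) where
  /-- The vertex at which the oriented edge starts. -/
  tail : G.edgeSet → α
  /-- The vertex at which the oriented edge ends. -/
  head : G.edgeSet → α
  isLink_tail_head : ∀ e : G.edgeSet, G.IsLink (e : β) (tail e) (head e)

/-- The set of edges with tail `v`. -/
def Orientation.outEdges {α β : Type*} {G : Graph α β} (D : G.Orientation) (v : α) :
    Set G.edgeSet :=
  {e | D.tail e = v}

/-- The set of edges with head `v`. -/
def Orientation.inEdges {α β : Type*} {G : Graph α β} (D : G.Orientation) (v : α) :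
    Set G.edgeSet :=
  {e | D.head e = v}

/-- `(D, φ)` is an `A`-flow: at every vertex the sum of `φ` over the outgoing edges equals the sum
over the incoming edges. (Used for graphs with finitely many edges, where these are finite sums.) -/
def Orientation.IsFlow {α β : Type*} {G : Graph α β} {A : Type*} [AddCommGroup A]
    (D : G.Orientation) (φ : G.edgeSet → A) : Prop :=
  ∀ v ∈ G.vertexSet, ∑ᶠ e ∈ D.outEdges v, φ e = ∑ᶠ e ∈ D.inEdges v, φ e

/-- `G` admits a nowhere-zero `k`-flow: an integer flow, with respect to some orientation, all of
whose values are non-zero and of absolute value less than `k`. -/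
def HasNowhereZeroFlow {α β : Type*} (G : Graph α β) (k : ℕ) : Prop :=
  ∃ (D : G.Orientation) (φ : G.edgeSet → ℤ),
    D.IsFlow φ ∧ ∀ e : G.edgeSet, φ e ≠ 0 ∧ |φ e| < (k : ℤ)

end Graph

/-!
The proof works with edges modulo 2. An edge with ends `x` and `y` is the vector `δ_x + δ_y` of
`V →₀ ZMod 2` (`edgeVec`), an edge set is even if its vectors add up to zero, and a nowhere-zero
flow with values in `ZMod 2 × ZMod 2` is a pair of relations between the edge vectors that do not
vanish simultaneously at any edge (`HasKleinFlow`). Such a flow yields a nowhere-zero integer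
4-flow (`HasKleinFlow.exists_int_flow`): its two coordinates are supported on even sets, which carry
integer flows with values `1` and `-1`, and these are added with the coefficients `1` and `2`.

The edge set of a cycle is even, so every edge lies in an even set of at most four edges. This
property passes to quotients of the graph, which makes an induction on the number of edges possible
(`ShortlyCovered.hasKleinFlow`), with three cases.

* There is a non-empty even set `S` of at most three edges. A flow on the graph with `S` contracted
  extends to `S`, where it takes at most three values; subtracting along `S` a group element which is
  not among these makes it nowhere zero (`HasKleinFlow.of_contract`).
* The graph is simple and triangle-free, and a four-cycle `C` meets some other four-cycle in an odd
  number of edges. Identifying opposite vertices of `C` makes its edges parallel; they are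
  replaced by a single edge. A nowhere-zero flow of the result lifts to one whose values on `C` have
  a nonzero sum. Since the four elements of the group add up to zero, one of them is again not a
  value on `C`, and can be subtracted along `C`. The odd intersection ensures that the new edge lies
  in a short even set (`HasKleinFlow.of_fourCycle`).
* The graph is simple and triangle-free, and any two four-cycles share an even number of edges. Two
  distinct four-cycles with a common edge then share a path of length two and form a `K_{2,3}`, and
  a maximal `K_{2,m}` containing it contains every four-cycle it meets
  (`exists_closed_of_even_inter`). Its edges are covered by two even subsets, so that it has a flow
  of its own and can be deleted.
-/

/-! ### Incidence vectors modulo 2 -/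

open Finsupp in
/-- The incidence vector modulo 2 of an edge with ends `x` and `y`; it is zero for a loop. -/
noncomputable def edgeVec {V : Type*} (x y : V) : V →₀ ZMod 2 :=
  single x 1 + single y 1

section EdgeVectors

variable {V : Type*}

theorem edgeVec_comm (x y : V) : edgeVec x y = edgeVec y x := add_comm _ _

theorem edgeVec_self (x : V) : edgeVec x x = 0 := ZModModule.add_self _

theorem edgeVec_add_edgeVec (x y z : V) : edgeVec x y + edgeVec y z = edgeVec x z := by
  unfold edgeVec
  rw [add_assoc, ← add_assoc (Finsupp.single y 1), ZModModule.add_self, zero_add]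

theorem mapDomain_edgeVec {V' : Type*} (π : V → V') (x y : V) :
    Finsupp.mapDomain π (edgeVec x y) = edgeVec (π x) (π y) := by
  simp [edgeVec, Finsupp.mapDomain_add]

open Classical in
theorem edgeVec_apply (x y z : V) :
    edgeVec x y z = (if x = z then 1 else 0) + (if y = z then 1 else 0) := by
  simp [edgeVec, Finsupp.single_apply]

theorem eq_or_eq_of_edgeVec_apply_ne_zero {x y z : V} (h : edgeVec x y z ≠ 0) :
    z = x ∨ z = y := by
  classical
  rw [edgeVec_apply] at h
  by_contra! hc
  simp [hc.1.symm, hc.2.symm] at h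

theorem edgeVec_apply_left {x y : V} (h : x ≠ y) : edgeVec x y x = 1 := by
  classical simp [edgeVec_apply, h.symm]

theorem edgeVec_apply_right {x y : V} (h : x ≠ y) : edgeVec x y y = 1 := by
  classical simp [edgeVec_apply, h]

theorem edgeVec_apply_of_ne {x y z : V} (hx : z ≠ x) (hy : z ≠ y) : edgeVec x y z = 0 := by
  classical simp [edgeVec_apply, hx.symm, hy.symm]

/-- An edge has at most two vertices of odd degree. -/
theorem not_edgeVec_apply_three {x y a b c : V} (hab : a ≠ b) (hac : a ≠ c) (hbc : b ≠ c)
    (ha : edgeVec x y a = 1) (hb : edgeVec x y b = 1) (hc : edgeVec x y c = 1) : False := by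
  have := eq_or_eq_of_edgeVec_apply_ne_zero (ha.trans_ne one_ne_zero)
  have := eq_or_eq_of_edgeVec_apply_ne_zero (hb.trans_ne one_ne_zero)
  have := eq_or_eq_of_edgeVec_apply_ne_zero (hc.trans_ne one_ne_zero)
  grind

theorem ZModModule.eq_of_add_eq_zero {W : Type*} [AddCommGroup W] [Module (ZMod 2) W] {a b : W}
    (h : a + b = 0) : a = b := by
  rw [add_eq_zero_iff_eq_neg, ZModModule.neg_eq_self] at h
  exact h

/-- Every quotient of `V →₀ ZMod 2` by a submodule `N` induces an identification `π` of vertices;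
`π` picks a representative of each class. -/
theorem exists_vertex_identification (N : Submodule (ZMod 2) (V →₀ ZMod 2)) :
    ∃ π : V → V, (∀ x y, edgeVec x y ∈ N → π x = π y) ∧
      ∀ u : V →₀ ZMod 2, Finsupp.mapDomain π u = 0 → u ∈ N := by
  let r : Setoid V :=
    { r := fun x y => edgeVec x y ∈ N
      iseqv :=
        { refl := fun x => by rw [edgeVec_self]; exact N.zero_mem
          symm := fun {x y} h => by rw [edgeVec_comm]; exact h
          trans := fun {x y z} h h' => by
            rw [← edgeVec_add_edgeVec x y z]; exact N.add_mem h h' } }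
  let π : V → V := fun x => (Quotient.mk r x).out
  refine ⟨π, fun x y h => ?_, fun u hu => ?_⟩
  · exact congrArg Quotient.out (Quotient.sound (s := r) h)
  · have key : ∀ u : V →₀ ZMod 2, u + Finsupp.mapDomain π u ∈ N := by
      intro u
      induction u using Finsupp.induction_linear with
      | zero => simp
      | add f g hf hg =>
        rw [Finsupp.mapDomain_add, add_add_add_comm]
        exact N.add_mem hf hg
      | single x c =>
        have hx : edgeVec x (π x) ∈ N :=
          r.symm (Quotient.exact (s := r) (Quotient.out_eq (Quotient.mk r x)))
        have := N.smul_mem c hx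
        simpa [edgeVec, Finsupp.mapDomain_single] using this
    simpa [hu] using key u

end EdgeVectors

/-! ### Flows with values in the Klein four-group and contraction -/

section Flows

variable {V β : Type*}

/-- `d` assigns to each edge in `E` the incidence vector of an edge on `V`, so that `(V, E, d)` is a
multigraph, whose loops have no recorded position. -/
def IsIncidence (d : β → V →₀ ZMod 2) (E : Finset β) : Prop :=
  ∀ e ∈ E, ∃ x y, d e = edgeVec x y

/-- Existence of a nowhere-zero flow on `E` with values in the Klein four-group
`ZMod 2 × ZMod 2`, given by its two coordinates. -/
def HasKleinFlow (d : β → V →₀ ZMod 2) (E : Finset β) : Prop :=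
  ∃ f : β → ZMod 2 × ZMod 2, ∑ e ∈ E, (f e).1 • d e = 0 ∧ ∑ e ∈ E, (f e).2 • d e = 0 ∧
    ∀ e ∈ E, f e ≠ 0

/-- Every edge in `E` lies in an even subset of `E` with at most four elements. -/
def ShortlyCovered (d : β → V →₀ ZMod 2) (E : Finset β) : Prop :=
  ∀ e ∈ E, ∃ T ⊆ E, e ∈ T ∧ T.card ≤ 4 ∧ ∑ x ∈ T, d x = 0

variable {d : β → V →₀ ZMod 2} {E : Finset β}

theorem IsIncidence.mono {F : Finset β} (h : IsIncidence d E) (hF : F ⊆ E) : IsIncidence d F :=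
  fun e he => h e (hF he)

theorem IsIncidence.mapDomain (h : IsIncidence d E) (π : V → V) :
    IsIncidence (fun e => Finsupp.mapDomain π (d e)) E := by
  intro e he
  obtain ⟨x, y, hxy⟩ := h e he
  exact ⟨π x, π y, by simp only [hxy, mapDomain_edgeVec]⟩

theorem sum_mapDomain (π : V → V) (S : Finset β) :
    ∑ e ∈ S, Finsupp.mapDomain π (d e) = Finsupp.mapDomain π (∑ e ∈ S, d e) :=
  (map_sum (Finsupp.mapDomain.addMonoidHom π) _ _).symm

theorem sum_smul_mapDomain (π : V → V) (S : Finset β) (a : β → ZMod 2) :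
    ∑ e ∈ S, a e • Finsupp.mapDomain π (d e) = Finsupp.mapDomain π (∑ e ∈ S, a e • d e) := by
  have := map_sum (Finsupp.lmapDomain (ZMod 2) (ZMod 2) π) (fun e => a e • d e) S
  simpa only [map_smul, Finsupp.lmapDomain_apply] using this.symm

theorem HasKleinFlow.of_even (h : ∑ e ∈ E, d e = 0) : HasKleinFlow d E :=
  ⟨fun _ => (1, 1), by simpa using h, by simpa using h, fun _ _ => by simp⟩

variable [DecidableEq β]

theorem sum_ite_mem_smul {S : Finset β} (hS : S ⊆ E) (a b : β → ZMod 2) :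
    ∑ e ∈ E, (if e ∈ S then a e else b e) • d e = ∑ e ∈ S, a e • d e + ∑ e ∈ E \ S, b e • d e := by
  rw [← Finset.sum_sdiff hS, add_comm]
  congr 1
  · exact Finset.sum_congr rfl fun e he => by rw [if_pos he]
  · exact Finset.sum_congr rfl fun e he => by rw [if_neg (Finset.mem_sdiff.1 he).2]

/-- A flow which omits some value on an even set `S` can be made nowhere zero on `S`, by subtracting
the omitted value along `S`. -/
theorem HasKleinFlow.of_shift {S : Finset β} (hS : S ⊆ E) (hS0 : ∑ e ∈ S, d e = 0)
    (f : β → ZMod 2 × ZMod 2) (h₁ : ∑ e ∈ E, (f e).1 • d e = 0) (h₂ : ∑ e ∈ E, (f e).2 • d e = 0)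
    (hne : ∀ e ∈ E \ S, f e ≠ 0) (c : ZMod 2 × ZMod 2) (hc : ∀ e ∈ S, f e ≠ c) :
    HasKleinFlow d E := by
  have hsum : ∀ a : ZMod 2, ∑ e ∈ E, (if e ∈ S then a else 0) • d e = 0 := by
    intro a
    rw [sum_ite_mem_smul hS (fun _ => a) fun _ => 0, ← Finset.smul_sum, hS0]
    simp
  refine ⟨fun e => f e - if e ∈ S then c else 0, ?_, ?_, fun e he => ?_⟩
  · simp only [Prod.fst_sub, sub_smul, Finset.sum_sub_distrib, h₁, apply_ite Prod.fst, Prod.fst_zero,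
      hsum, sub_zero]
  · simp only [Prod.snd_sub, sub_smul, Finset.sum_sub_distrib, h₂, apply_ite Prod.snd, Prod.snd_zero,
      hsum, sub_zero]
  · by_cases heS : e ∈ S
    · simpa [heS, sub_eq_zero] using hc e heS
    · simpa [heS] using hne e (by simp [he, heS])

theorem HasKleinFlow.union_sdiff {F : Finset β} (hF : F ⊆ E) (h : HasKleinFlow d F)
    (h' : HasKleinFlow d (E \ F)) : HasKleinFlow d E := by
  obtain ⟨f, f₁, f₂, f₀⟩ := h
  obtain ⟨g, g₁, g₂, g₀⟩ := h'
  refine ⟨fun e => if e ∈ F then f e else g e, ?_, ?_, fun e he => ?_⟩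
  · simp only [apply_ite Prod.fst, sum_ite_mem_smul hF, f₁, g₁, add_zero]
  · simp only [apply_ite Prod.snd, sum_ite_mem_smul hF, f₂, g₂, add_zero]
  · by_cases heF : e ∈ F
    · simpa [heF] using f₀ e heF
    · simpa [heF] using g₀ e (by simp [he, heF])

/-- An edge set that is the union of two even subsets has a nowhere-zero flow. -/
theorem HasKleinFlow.of_cover {A B : Finset β} (hA : A ⊆ E) (hB : B ⊆ E) (hAB : E ⊆ A ∪ B)
    (hA0 : ∑ e ∈ A, d e = 0) (hB0 : ∑ e ∈ B, d e = 0) : HasKleinFlow d E := by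
  have hsum : ∀ S ⊆ E, ∑ e ∈ S, d e = 0 →
      ∑ e ∈ E, (if e ∈ S then (1 : ZMod 2) else 0) • d e = 0 := by
    intro S hS hS0
    rw [sum_ite_mem_smul hS (fun _ => 1) fun _ => 0, ← Finset.smul_sum, hS0]
    simp
  refine ⟨fun e => (if e ∈ A then 1 else 0, if e ∈ B then 1 else 0), hsum A hA hA0, hsum B hB hB0,
    fun e he => ?_⟩
  rcases Finset.mem_union.1 (hAB he) with h | h <;> simp [h]

/-- Contraction of an even set `S` with at most three edges: a flow on the contracted graph
extends to `S`, and a suitable constant added along `S` makes it nowhere zero because the group has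
four elements. -/
theorem HasKleinFlow.of_contract {S : Finset β} (hS : S ⊆ E) (hS0 : ∑ e ∈ S, d e = 0)
    (hcard : S.card ≤ 3) (hd : IsIncidence d E) (hcov : ShortlyCovered d E)
    (ih : ∀ d' : β → V →₀ ZMod 2, IsIncidence d' (E \ S) → ShortlyCovered d' (E \ S) →
      HasKleinFlow d' (E \ S)) :
    HasKleinFlow d E := by
  obtain ⟨π, hπ, hker⟩ := exists_vertex_identification (Submodule.span (ZMod 2) (d '' S))
  have hzero : ∀ e ∈ S, Finsupp.mapDomain π (d e) = 0 := by
    intro e he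
    obtain ⟨x, y, hxy⟩ := hd e (hS he)
    have hmem : edgeVec x y ∈ Submodule.span (ZMod 2) (d '' S) :=
      hxy ▸ Submodule.subset_span ⟨e, he, rfl⟩
    rw [hxy, mapDomain_edgeVec, hπ x y hmem, edgeVec_self]
  obtain ⟨f, f₁, f₂, f₀⟩ := ih (fun e => Finsupp.mapDomain π (d e))
    ((hd.mapDomain π).mono Finset.sdiff_subset) (by
      intro e he
      obtain ⟨heE, heS⟩ := Finset.mem_sdiff.1 he
      obtain ⟨T, hTE, heT, hT4, hT0⟩ := hcov e heE
      refine ⟨T \ S, Finset.sdiff_subset_sdiff hTE subset_rfl, by simp [heT, heS],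
        (Finset.card_le_card Finset.sdiff_subset).trans hT4, ?_⟩
      have h1 := sum_mapDomain (d := d) π T
      rw [hT0, Finsupp.mapDomain_zero, ← Finset.sum_inter_add_sum_sdiff T S,
        Finset.sum_eq_zero (s := T ∩ S) fun x hx => hzero x (Finset.mem_inter.1 hx).2,
        zero_add] at h1
      exact h1)
  have hlift : ∀ a : β → ZMod 2, ∑ e ∈ E \ S, a e • Finsupp.mapDomain π (d e) = 0 →
      ∃ g : β → ZMod 2, ∑ e ∈ S, g e • d e = ∑ e ∈ E \ S, a e • d e := by
    intro a ha
    rw [sum_smul_mapDomain] at ha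
    obtain ⟨c, hc⟩ := (Submodule.mem_span_image_finset_iff_exists_fun (ZMod 2)).1 (hker _ ha)
    refine ⟨fun e => if h : e ∈ S then c ⟨e, h⟩ else 0, ?_⟩
    rw [← hc, ← Finset.sum_coe_sort S]
    simp
  obtain ⟨g₁, hg₁⟩ := hlift _ f₁
  obtain ⟨g₂, hg₂⟩ := hlift _ f₂
  obtain ⟨c, hc⟩ : ∃ c : ZMod 2 × ZMod 2, c ∉ S.image fun e => (g₁ e, g₂ e) := by
    by_contra! hall
    have h1 := Finset.card_le_card (s := Finset.univ) fun c _ => hall c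
    have h2 := Finset.card_image_le (s := S) (f := fun e => (g₁ e, g₂ e))
    have h3 : (Finset.univ : Finset (ZMod 2 × ZMod 2)).card = 4 := rfl
    omega
  refine HasKleinFlow.of_shift hS hS0 (fun e => if e ∈ S then (g₁ e, g₂ e) else f e) ?_ ?_ ?_ c ?_
  · simp only [apply_ite Prod.fst, sum_ite_mem_smul hS, hg₁, ZModModule.add_self]
  · simp only [apply_ite Prod.snd, sum_ite_mem_smul hS, hg₂, ZModModule.add_self]
  · intro e he
    simpa [(Finset.mem_sdiff.1 he).2] using f₀ e he
  · rintro e he rfl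
    exact hc (Finset.mem_image.2 ⟨e, he, by simp [he]⟩)

end Flows

/-! ### Four-cycles in triangle-free graphs -/

section FourCycles

variable {V β : Type*} {d : β → V →₀ ZMod 2} {E : Finset β}

/-- `e₁, e₂, e₃, e₄` are the consecutive edges, and `x₁, x₂, x₃, x₄` the consecutive vertices, of a
cycle of length four; `eᵢ` joins `xᵢ` to the next vertex. -/
structure IsFourCycle (d : β → V →₀ ZMod 2) (e₁ e₂ e₃ e₄ : β) (x₁ x₂ x₃ x₄ : V) : Prop where
  edge₁ : d e₁ = edgeVec x₁ x₂
  edge₂ : d e₂ = edgeVec x₂ x₃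
  edge₃ : d e₃ = edgeVec x₃ x₄
  edge₄ : d e₄ = edgeVec x₄ x₁
  edges_nodup : [e₁, e₂, e₃, e₄].Nodup
  vertices_nodup : [x₁, x₂, x₃, x₄].Nodup

theorem IsFourCycle.reverse {e₁ e₂ e₃ e₄ : β} {x₁ x₂ x₃ x₄ : V}
    (h : IsFourCycle d e₁ e₂ e₃ e₄ x₁ x₂ x₃ x₄) : IsFourCycle d e₁ e₄ e₃ e₂ x₂ x₁ x₄ x₃ where
  edge₁ := h.edge₁.trans (edgeVec_comm _ _)
  edge₂ := h.edge₄.trans (edgeVec_comm _ _)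
  edge₃ := h.edge₃.trans (edgeVec_comm _ _)
  edge₄ := h.edge₂.trans (edgeVec_comm _ _)
  edges_nodup := by have := h.edges_nodup; simp at this ⊢; grind
  vertices_nodup := by have := h.vertices_nodup; simp at this ⊢; grind

/-- Every non-empty even subset of `E` has at least four elements; equivalently, `(V, E, d)` is a
triangle-free simple graph. -/
def HasGirthFour (d : β → V →₀ ZMod 2) (E : Finset β) : Prop :=
  ∀ S ⊆ E, S.Nonempty → ∑ e ∈ S, d e = 0 → 4 ≤ S.card

theorem HasGirthFour.ne_zero (h : HasGirthFour d E) {e : β} (he : e ∈ E) : d e ≠ 0 := by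
  intro h0
  have := h {e} (by simpa) (by simp) (by simpa)
  simp at this

theorem IsIncidence.exists_eq_edgeVec (hd : IsIncidence d E) {e : β} (he : e ∈ E) {x : V}
    (hx : d e x ≠ 0) : ∃ y, d e = edgeVec x y := by
  obtain ⟨p, q, hpq⟩ := hd e he
  rw [hpq] at hx
  rcases eq_or_eq_of_edgeVec_apply_ne_zero hx with rfl | rfl
  · exact ⟨q, hpq⟩
  · exact ⟨p, hpq.trans (edgeVec_comm _ _)⟩

variable [DecidableEq β]

theorem HasGirthFour.injOn (h : HasGirthFour d E) {e e' : β} (he : e ∈ E) (he' : e' ∈ E)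
    (hd : d e = d e') : e = e' := by
  by_contra hne
  have := h {e, e'} (by simp [Finset.insert_subset_iff, *]) (by simp)
    (by rw [Finset.sum_pair hne, hd, ZModModule.add_self])
  rw [Finset.card_pair hne] at this
  omega

theorem HasGirthFour.add_add_ne_zero (h : HasGirthFour d E) {e e' e'' : β} (he : e ∈ E)
    (he' : e' ∈ E) (he'' : e'' ∈ E) : d e + d e' + d e'' ≠ 0 := by
  intro h0
  by_cases h1 : e = e'
  · subst h1
    rw [ZModModule.add_self, zero_add] at h0
    exact h.ne_zero he'' h0
  by_cases h2 : e = e''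
  · subst h2
    rw [add_right_comm, ZModModule.add_self, zero_add] at h0
    exact h.ne_zero he' h0
  by_cases h3 : e' = e''
  · subst h3
    rw [add_assoc, ZModModule.add_self, add_zero] at h0
    exact h.ne_zero he h0
  have := h {e, e', e''} (by simp [Finset.insert_subset_iff, *]) (by simp)
    (by rw [Finset.sum_insert (by simp [h1, h2]), Finset.sum_pair h3, ← add_assoc, h0])
  rw [Finset.card_insert_of_notMem (by simp [h1, h2]), Finset.card_pair h3] at this
  omega

/-- At an end of an edge of an even set, another edge of the set can be found. -/
theorem exists_next_edge {C : Finset β} (hC : ∑ e ∈ C, d e = 0) {e : β} (he : e ∈ C) {x y : V}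
    (hxy : d e = edgeVec x y) (hne : x ≠ y) : ∃ e' ∈ C, e' ≠ e ∧ d e' y ≠ 0 := by
  have h1 : (∑ f ∈ C, d f) y = 0 := by rw [hC]; rfl
  rw [Finsupp.finsetSum_apply, ← Finset.add_sum_erase C _ he, hxy, edgeVec_apply_right hne] at h1
  obtain ⟨e', he', hy⟩ : ∃ e' ∈ C.erase e, d e' y ≠ 0 := by
    by_contra! hall
    rw [Finset.sum_eq_zero hall] at h1
    simp at h1
  obtain ⟨hne', heC⟩ := Finset.mem_erase.1 he'
  exact ⟨e', heC, hne', hy⟩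

theorem HasGirthFour.exists_isFourCycle (h : HasGirthFour d E) (hd : IsIncidence d E)
    {C : Finset β} (hCE : C ⊆ E) (hcard : C.card = 4) (hC : ∑ e ∈ C, d e = 0) {e₁ : β}
    (he₁ : e₁ ∈ C) :
    ∃ e₂ e₃ e₄ x₁ x₂ x₃ x₄, C = {e₁, e₂, e₃, e₄} ∧ IsFourCycle d e₁ e₂ e₃ e₄ x₁ x₂ x₃ x₄ := by
  have hdC := hd.mono hCE
  have hloop : ∀ e ∈ C, ∀ x y, d e = edgeVec x y → x ≠ y := by
    rintro e he x _ hx rfl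
    exact h.ne_zero (hCE he) (hx.trans (edgeVec_self x))
  obtain ⟨x₁, x₂, h₁⟩ := hdC e₁ he₁
  have h12 := hloop _ he₁ _ _ h₁
  obtain ⟨e₂, he₂, e21, hx₂⟩ := exists_next_edge hC he₁ h₁ h12
  obtain ⟨x₃, h₂⟩ := hdC.exists_eq_edgeVec he₂ hx₂
  have h23 := hloop _ he₂ _ _ h₂
  have h13 : x₁ ≠ x₃ := by
    rintro rfl
    exact e21 (h.injOn (hCE he₂) (hCE he₁) (by rw [h₁, h₂, edgeVec_comm]))
  obtain ⟨e₃, he₃, e32, hx₃⟩ := exists_next_edge hC he₂ h₂ h23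
  obtain ⟨x₄, h₃⟩ := hdC.exists_eq_edgeVec he₃ hx₃
  have h34 := hloop _ he₃ _ _ h₃
  have e31 : e₃ ≠ e₁ := by
    rintro rfl
    have := edgeVec_apply_left h34
    rw [← h₃, h₁, edgeVec_apply_of_ne h13.symm h23.symm] at this
    exact absurd this (by decide)
  have h24 : x₂ ≠ x₄ := by
    rintro rfl
    exact e32 (h.injOn (hCE he₃) (hCE he₂) (by rw [h₃, h₂, edgeVec_comm]))
  have h14 : x₁ ≠ x₄ := by
    rintro rfl
    refine h.add_add_ne_zero (hCE he₁) (hCE he₂) (hCE he₃) ?_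
    rw [h₁, h₂, h₃, edgeVec_add_edgeVec, edgeVec_add_edgeVec, edgeVec_self]
  have hsub : {e₁, e₂, e₃} ⊆ C := by simp [Finset.insert_subset_iff, *]
  have h3 : ({e₁, e₂, e₃} : Finset β).card = 3 := by
    rw [Finset.card_eq_three]; exact ⟨e₁, e₂, e₃, e21.symm, e31.symm, e32.symm, rfl⟩
  obtain ⟨e₄, he₄⟩ : ∃ e₄, C \ {e₁, e₂, e₃} = {e₄} := by
    rw [← Finset.card_eq_one, Finset.card_sdiff_of_subset hsub, hcard, h3]
  have hmem : e₄ ∈ C \ {e₁, e₂, e₃} := by simp [he₄]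
  simp only [Finset.mem_sdiff, Finset.mem_insert, Finset.mem_singleton, not_or] at hmem
  have hCeq : C = {e₁, e₂, e₃, e₄} := by
    rw [← Finset.sdiff_union_of_subset hsub, he₄]
    ext; simp; tauto
  refine ⟨e₂, e₃, e₄, x₁, x₂, x₃, x₄, hCeq, h₁, h₂, h₃, ?_, ?_, ?_⟩
  · rw [← Finset.sum_sdiff hsub, he₄, Finset.sum_singleton, Finset.sum_insert (by simp [*, Ne.symm]),
      Finset.sum_pair e32.symm, h₁, h₂, h₃, ← add_assoc (edgeVec x₁ x₂), edgeVec_add_edgeVec,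
      edgeVec_add_edgeVec] at hC
    rw [ZModModule.eq_of_add_eq_zero hC, edgeVec_comm]
  · simp; grind
  · simp; grind

end FourCycles

/-! ### Reductions at four-cycles and complete bipartite graphs -/

section FourCycleReductions

variable {V β : Type*} {d : β → V →₀ ZMod 2} {E : Finset β} [DecidableEq β]

theorem exists_notMem_of_sum_ne_zero (a b c e : ZMod 2 × ZMod 2) (h : a + b + c + e ≠ 0) :
    ∃ k, a ≠ k ∧ b ≠ k ∧ c ≠ k ∧ e ≠ k := by
  revert a b c e; decide

/-- Catlin's reduction. Identifying the opposite vertices of a four-cycle `C` turns its edges into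
four parallel edges, of which only `e₁` is kept. The values on `C` of a lifted flow add up to its
nonzero value at `e₁`, so that they cannot be the four distinct elements of the group. The smaller
graph is shortly covered provided that `e₁` is, and this is what the even set `T₀`, which meets `C`
in an odd number of edges, is for. -/
theorem HasKleinFlow.of_fourCycle (hd : IsIncidence d E) (hcov : ShortlyCovered d E)
    {C : Finset β} (hCE : C ⊆ E) {e₁ e₂ e₃ e₄ : β} {x₁ x₂ x₃ x₄ : V}
    (hCe : C = {e₁, e₂, e₃, e₄}) (hC : IsFourCycle d e₁ e₂ e₃ e₄ x₁ x₂ x₃ x₄)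
    {T₀ : Finset β} (hT₀E : T₀ ⊆ E) (hT₀4 : T₀.card ≤ 4) (hT₀0 : ∑ e ∈ T₀, d e = 0)
    (hodd : Odd (T₀ ∩ C).card)
    (ih : ∀ d' : β → V →₀ ZMod 2, IsIncidence d' (insert e₁ (E \ C)) →
      ShortlyCovered d' (insert e₁ (E \ C)) → HasKleinFlow d' (insert e₁ (E \ C))) :
    HasKleinFlow d E := by
  have hnd := hC.edges_nodup
  simp only [List.nodup_cons, List.mem_cons, List.not_mem_nil, or_false, not_or, not_false_eq_true,
    List.nodup_nil, and_true] at hnd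
  obtain ⟨⟨n12, n13, n14⟩, ⟨n23, n24⟩, n34⟩ := hnd
  have he₁C : e₁ ∈ C := by simp [hCe]
  have hsumC : ∀ F : β → V →₀ ZMod 2,
      ∑ e ∈ C, F e = F e₁ + (F e₂ + (F e₃ + F e₄)) := by
    intro F
    rw [hCe, Finset.sum_insert (by simp [*]), Finset.sum_insert (by simp [*]), Finset.sum_pair n34]
  have hC0 : ∑ e ∈ C, d e = 0 := by
    rw [hsumC, hC.edge₁, hC.edge₂, hC.edge₃, hC.edge₄, edgeVec_add_edgeVec, edgeVec_add_edgeVec,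
      edgeVec_add_edgeVec, edgeVec_self]
  obtain ⟨π, hπ, hker⟩ := exists_vertex_identification
    (Submodule.span (ZMod 2) {edgeVec x₁ x₃, edgeVec x₂ x₄})
  have h13 : π x₁ = π x₃ := hπ _ _ (Submodule.subset_span (by simp))
  have h24 : π x₂ = π x₄ := hπ _ _ (Submodule.subset_span (by simp))
  have hpar : ∀ e ∈ C, Finsupp.mapDomain π (d e) = Finsupp.mapDomain π (d e₁) := by
    intro e he
    simp only [hCe, Finset.mem_insert, Finset.mem_singleton] at he
    rcases he with rfl | rfl | rfl | rfl
    · rfl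
    · rw [hC.edge₁, hC.edge₂, mapDomain_edgeVec, mapDomain_edgeVec, h13, edgeVec_comm]
    · rw [hC.edge₁, hC.edge₃, mapDomain_edgeVec, mapDomain_edgeVec, h13, h24]
    · rw [hC.edge₁, hC.edge₄, mapDomain_edgeVec, mapDomain_edgeVec, h24, edgeVec_comm]
  have hE' : insert e₁ (E \ C) ⊆ E :=
    Finset.insert_subset (hCE he₁C) Finset.sdiff_subset
  have he₁' : e₁ ∉ E \ C := by simp [he₁C]
  -- The image of an even set: its edges in `C` cancel in pairs, up to at most one.
  have himage : ∀ T ⊆ E, T.card ≤ 4 → ∑ e ∈ T, d e = 0 →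
      ∃ T' ⊆ insert e₁ (E \ C), T'.card ≤ 4 ∧ ∑ e ∈ T', Finsupp.mapDomain π (d e) = 0 ∧
        T \ C ⊆ T' ∧ (Odd (T ∩ C).card → e₁ ∈ T') := by
    intro T hTE hT4 hT0
    have hsum : (T ∩ C).card • Finsupp.mapDomain π (d e₁) +
        ∑ e ∈ T \ C, Finsupp.mapDomain π (d e) = 0 := by
      rw [← Finset.sum_const, ← Finset.sum_congr rfl fun e he => hpar e (Finset.mem_inter.1 he).2,
        Finset.sum_inter_add_sum_sdiff, sum_mapDomain, hT0, Finsupp.mapDomain_zero]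
    have hsplit : (T ∩ C).card + (T \ C).card = T.card := Finset.card_inter_add_card_sdiff T C
    have hsub : T \ C ⊆ E \ C := Finset.sdiff_subset_sdiff hTE subset_rfl
    rcases Nat.even_or_odd (T ∩ C).card with hev | hod
    · refine ⟨T \ C, hsub.trans (Finset.subset_insert _ _), by omega, ?_, subset_rfl,
        fun ho => absurd hev (Nat.not_even_iff_odd.2 ho)⟩
      obtain ⟨k, hk⟩ := hev
      rwa [hk, add_smul, ZModModule.add_self, zero_add] at hsum
    · refine ⟨insert e₁ (T \ C), Finset.insert_subset_insert _ hsub, ?_, ?_,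
        Finset.subset_insert _ _, fun _ => Finset.mem_insert_self _ _⟩
      · have := Finset.card_insert_le e₁ (T \ C)
        have := hod.pos
        omega
      · obtain ⟨k, hk⟩ := hod
        rw [Finset.sum_insert (by simp [he₁C])]
        rwa [hk, add_smul, two_mul, add_smul, ZModModule.add_self, zero_add, one_smul] at hsum
  obtain ⟨f, f₁, f₂, f₀⟩ := ih (fun e => Finsupp.mapDomain π (d e))
    ((hd.mapDomain π).mono hE') (by
      intro e he
      rcases Finset.mem_insert.1 he with rfl | he
      · obtain ⟨T', h1, h2, h3, -, h5⟩ := himage T₀ hT₀E hT₀4 hT₀0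
        exact ⟨T', h1, h5 hodd, h2, h3⟩
      · obtain ⟨heE, heC⟩ := Finset.mem_sdiff.1 he
        obtain ⟨T, hTE, heT, hT4, hT0⟩ := hcov e heE
        obtain ⟨T', h1, h2, h3, h4, -⟩ := himage T hTE hT4 hT0
        exact ⟨T', h1, h4 (by simp [heT, heC]), h2, h3⟩)
  have hlift : ∀ a : β → ZMod 2,
      ∑ e ∈ insert e₁ (E \ C), a e • Finsupp.mapDomain π (d e) = 0 →
      ∃ g : β → ZMod 2, ∑ e ∈ C, g e • d e + ∑ e ∈ E \ C, a e • d e = 0 ∧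
        g e₁ + g e₂ + g e₃ + g e₄ = a e₁ := by
    intro a ha
    rw [sum_smul_mapDomain] at ha
    obtain ⟨p, q, hpq⟩ := Submodule.mem_span_pair.1 (hker _ ha)
    -- The lifted values use `x₁ - x₃ = d e₁ + d e₂` and `x₂ - x₄ = d e₂ + d e₃`.
    let g : β → ZMod 2 := fun e =>
      if e = e₁ then a e₁ + p else if e = e₂ then p + q else if e = e₃ then q else 0
    have g1 : g e₁ = a e₁ + p := by simp [g]
    have g2 : g e₂ = p + q := by simp [g, Ne.symm n12]
    have g3 : g e₃ = q := by simp [g, Ne.symm n13, Ne.symm n23]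
    have g4 : g e₄ = 0 := by simp [g, Ne.symm n14, Ne.symm n24, Ne.symm n34]
    refine ⟨g, ?_, ?_⟩
    · rw [Finset.sum_insert he₁'] at hpq
      rw [hsumC, g1, g2, g3, g4, zero_smul, add_zero]
      have hx13 : edgeVec x₁ x₃ = d e₁ + d e₂ := by
        rw [hC.edge₁, hC.edge₂, edgeVec_add_edgeVec]
      have hx24 : edgeVec x₂ x₄ = d e₂ + d e₃ := by
        rw [hC.edge₂, hC.edge₃, edgeVec_add_edgeVec]
      rw [hx13, hx24] at hpq
      calc _ = (p • (d e₁ + d e₂) + q • (d e₂ + d e₃)) +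
            (a e₁ • d e₁ + ∑ e ∈ E \ C, a e • d e) := by module
        _ = 0 := by rw [hpq, ZModModule.add_self]
    · rw [g1, g2, g3, g4]
      have : ∀ p q r : ZMod 2, r + p + (p + q) + q + 0 = r := by decide
      exact this _ _ _
  obtain ⟨g₁, hg₁, hs₁⟩ := hlift _ f₁
  obtain ⟨g₂, hg₂, hs₂⟩ := hlift _ f₂
  obtain ⟨c, c1, c2, c3, c4⟩ := exists_notMem_of_sum_ne_zero (g₁ e₁, g₂ e₁) (g₁ e₂, g₂ e₂)
    (g₁ e₃, g₂ e₃) (g₁ e₄, g₂ e₄) (by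
      have := f₀ e₁ (Finset.mem_insert_self _ _)
      rwa [← Prod.mk.eta (p := f e₁), ← hs₁, ← hs₂] at this)
  refine HasKleinFlow.of_shift hCE hC0 (fun e => if e ∈ C then (g₁ e, g₂ e) else f e) ?_ ?_ ?_ c ?_
  · simp only [apply_ite Prod.fst, sum_ite_mem_smul hCE, hg₁]
  · simp only [apply_ite Prod.snd, sum_ite_mem_smul hCE, hg₂]
  · intro e he
    simpa [(Finset.mem_sdiff.1 he).2] using f₀ e (Finset.mem_insert_of_mem he)
  · intro e he
    rw [if_pos he]
    simp only [hCe, Finset.mem_insert, Finset.mem_singleton] at he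
    rcases he with rfl | rfl | rfl | rfl <;> assumption

theorem sum_eq_zero_or_eq_of_pairing {w : V →₀ ZMod 2} (hw : w ≠ 0) (n : ℕ) (F : Finset β)
    (hn : F.card = n) (hinj : Set.InjOn d F) (hF : ∀ e ∈ F, ∃ e' ∈ F, d e + d e' = w) :
    ∑ e ∈ F, d e = 0 ∨ ∑ e ∈ F, d e = w := by
  induction n using Nat.strong_induction_on generalizing F with
  | _ n ih =>
    rcases F.eq_empty_or_nonempty with rfl | ⟨e, he⟩
    · simp
    obtain ⟨e', he', hee⟩ := hF e he
    have hne : e ≠ e' := by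
      rintro rfl
      exact hw (hee.symm.trans (ZModModule.add_self _))
    have hsub : {e, e'} ⊆ F := by simp [Finset.insert_subset_iff, *]
    have hpair : ∀ {x y z : β}, x ∈ F → z ∈ F → d x + d y = w → d z + d y = w → x = z :=
      fun hx hz h h' => hinj hx hz (add_right_cancel (h.trans h'.symm))
    have hlt : (F \ {e, e'}).card < n := by
      rw [← hn]
      exact Finset.card_lt_card (Finset.sdiff_ssubset hsub (by simp))
    have := ih _ hlt (F \ {e, e'}) rfl (hinj.mono (by simp)) (by
      intro x hx
      simp only [Finset.mem_sdiff, Finset.mem_insert, Finset.mem_singleton, not_or] at hx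
      obtain ⟨hxF, hxe, hxe'⟩ := hx
      obtain ⟨y, hyF, hxy⟩ := hF x hxF
      refine ⟨y, ?_, hxy⟩
      simp only [Finset.mem_sdiff, Finset.mem_insert, Finset.mem_singleton, not_or]
      refine ⟨hyF, ?_, ?_⟩
      · rintro rfl
        exact hxe' (hpair hxF he' hxy (by rwa [add_comm]))
      · rintro rfl
        exact hxe (hpair hxF he hxy hee))
    rw [← Finset.sum_sdiff hsub, Finset.sum_pair hne, hee]
    rcases this with h | h
    · right; rw [h, zero_add]
    · left; rw [h, ZModModule.add_self]

/-- The set `F` of edges which can be completed to a pair with sum `w` is a union of disjoint such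
pairs, and has a nowhere-zero flow as soon as there are two of them. -/
theorem HasKleinFlow.of_pairing {w : V →₀ ZMod 2} (hw : w ≠ 0) {F : Finset β}
    (hinj : Set.InjOn d F) (hF : ∀ e ∈ F, ∃ e' ∈ F, d e + d e' = w)
    {a a' b b' : β} (ha : a ∈ F) (ha' : a' ∈ F) (hb : b ∈ F) (hb' : b' ∈ F)
    (haa : d a + d a' = w) (hbb : d b + d b' = w) (hab : a ≠ b) (hab' : a ≠ b') :
    HasKleinFlow d F := by
  rcases sum_eq_zero_or_eq_of_pairing hw _ F rfl hinj hF with h | h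
  · exact .of_even h
  have hne : ∀ {x y : β}, d x + d y = w → x ≠ y := by
    rintro x _ hx rfl
    exact hw (hx.symm.trans (ZModModule.add_self _))
  have hsum : ∀ x ∈ F, ∀ y ∈ F, d x + d y = w → ∑ e ∈ F \ {x, y}, d e = 0 := by
    intro x hx y hy hxy
    rw [← Finset.sum_sdiff (s₁ := {x, y}) (by simp [Finset.insert_subset_iff, *]),
      Finset.sum_pair (hne hxy), hxy] at h
    simpa using h
  have hab1 : a' ≠ b := by
    rintro rfl
    exact hab' (hinj ha hb' (add_right_cancel (haa.trans (by rw [add_comm, hbb]))))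
  have hab2 : a' ≠ b' := by
    rintro rfl
    exact hab (hinj ha hb (add_right_cancel (haa.trans hbb.symm)))
  refine .of_cover (A := F \ {a, a'}) (B := F \ {b, b'}) Finset.sdiff_subset Finset.sdiff_subset ?_
    (hsum a ha a' ha' haa) (hsum b hb b' hb' hbb)
  intro e he
  simp only [Finset.mem_union, Finset.mem_sdiff, Finset.mem_insert, Finset.mem_singleton]
  grind

end FourCycleReductions

/-! ### Four-cycles with even intersections -/

section EvenIntersections

variable {V β : Type*} {d : β → V →₀ ZMod 2} {E : Finset β}

theorem ZMod.eq_one_or_eq_one_of_add_eq_one {a b : ZMod 2} (h : a + b = 1) : a = 1 ∨ b = 1 := by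
  revert a b; decide

theorem ZMod.eq_one_of_one_add_eq_zero {a : ZMod 2} (h : 1 + a = 0) : a = 1 := by
  revert a; decide

/-- A path of length two that joins opposite vertices of a four-cycle and avoids its edges has its
midpoint `y` outside the cycle. -/
theorem IsFourCycle.exists_path [DecidableEq β] (h : HasGirthFour d E) (hd : IsIncidence d E)
    {e₁ e₂ e₃ e₄ : β} {x₁ x₂ x₃ x₄ : V} (hC : IsFourCycle d e₁ e₂ e₃ e₄ x₁ x₂ x₃ x₄)
    (he₁ : e₁ ∈ E) (he₄ : e₄ ∈ E) {g g' : β} (hg : g ∈ E)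
    (hg' : g' ∈ E) (hgg : d g + d g' = edgeVec x₁ x₃) (hg1 : d g x₁ = 1)
    (n1 : g ≠ e₁) (n4 : g ≠ e₄) :
    ∃ y, y ≠ x₁ ∧ y ≠ x₂ ∧ y ≠ x₃ ∧ y ≠ x₄ ∧ d g = edgeVec x₁ y ∧ d g' = edgeVec y x₃ := by
  obtain ⟨y, hy⟩ := hd.exists_eq_edgeVec hg (x := x₁) (by rw [hg1]; decide)
  have hy' : d g' = edgeVec y x₃ := by
    have : d g' = d g + edgeVec x₁ x₃ := by rw [← hgg, ← add_assoc, ZModModule.add_self, zero_add]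
    rw [this, hy, edgeVec_comm x₁ y, edgeVec_add_edgeVec]
  refine ⟨y, ?_, ?_, ?_, ?_, hy, hy'⟩
  · rintro rfl
    exact h.ne_zero hg (hy.trans (edgeVec_self _))
  · rintro rfl
    exact n1 (h.injOn hg he₁ (hy.trans hC.edge₁.symm))
  · rintro rfl
    exact h.ne_zero hg' (hy'.trans (edgeVec_self _))
  · rintro rfl
    exact n4 (h.injOn hg he₄ (by rw [hy, hC.edge₄, edgeVec_comm]))

/-- In a triangle-free graph, two four-cycles cannot share exactly a pair of opposite edges. -/
theorem IsFourCycle.opposite_false [DecidableEq β] (h : HasGirthFour d E) (hd : IsIncidence d E)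
    {e₁ e₂ e₃ e₄ : β} {x₁ x₂ x₃ x₄ : V} (hC : IsFourCycle d e₁ e₂ e₃ e₄ x₁ x₂ x₃ x₄)
    (he₁ : e₁ ∈ E) (he₂ : e₂ ∈ E) (he₄ : e₄ ∈ E) {g g' : β} (hg : g ∈ E)
    (hg' : g' ∈ E) (hgg : d g + d g' = d e₁ + d e₃) (hg1 : d g x₁ = 1)
    (n1 : g ≠ e₁) (n4 : g ≠ e₄) : False := by
  obtain ⟨y, hy⟩ := hd.exists_eq_edgeVec hg (x := x₁) (by rw [hg1]; decide)
  have hv := hC.vertices_nodup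
  simp only [List.nodup_cons, List.mem_cons, List.not_mem_nil, or_false, not_or, not_false_eq_true,
    List.nodup_nil, and_true] at hv
  obtain ⟨⟨v12, v13, v14⟩, ⟨v23, v24⟩, v34⟩ := hv
  have y2 : y ≠ x₂ := by
    rintro rfl
    exact n1 (h.injOn hg he₁ (hy.trans hC.edge₁.symm))
  have y3 : y ≠ x₃ := by
    rintro rfl
    refine h.add_add_ne_zero he₁ he₂ hg ?_
    rw [hC.edge₁, hC.edge₂, hy, edgeVec_add_edgeVec, ZModModule.add_self]
  have y4 : y ≠ x₄ := by
    rintro rfl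
    exact n4 (h.injOn hg he₄ (by rw [hy, hC.edge₄, edgeVec_comm]))
  obtain ⟨p, q, hpq⟩ := hd g' hg'
  have hsum : edgeVec p q = edgeVec x₁ y + (edgeVec x₁ x₂ + edgeVec x₃ x₄) := by
    rw [← hC.edge₁, ← hC.edge₃, ← hgg, hy, ← hpq, ← add_assoc, ZModModule.add_self, zero_add]
  refine not_edgeVec_apply_three (x := p) (y := q) v23 v24 v34 ?_ ?_ ?_
  all_goals
    classical
    rw [hsum]
    simp [edgeVec_apply, *, Ne.symm v23, Ne.symm v24, Ne.symm v34]

/-- Suppose that any two four-cycles share an even number of edges. The maximal complete bipartite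
graph `K_{2,m}` that contains three given paths of length two with the same ends then contains
every four-cycle that it meets: another one would meet each of the three paths in a
single edge, and would have odd degree at their three midpoints without its fourth edge. -/
theorem exists_closed_of_three_paths [DecidableEq β] (h : HasGirthFour d E) (hd : IsIncidence d E)
    (heven : ∀ T ⊆ E, ∀ T' ⊆ E, T.card = 4 → T'.card = 4 → ∑ e ∈ T, d e = 0 →
      ∑ e ∈ T', d e = 0 → Even (T ∩ T').card)
    {a b y₁ y₂ y₃ : V} {p₁ q₁ p₂ q₂ p₃ q₃ : β}
    (hp₁E : p₁ ∈ E) (hq₁E : q₁ ∈ E) (hp₂E : p₂ ∈ E) (hq₂E : q₂ ∈ E) (hp₃E : p₃ ∈ E) (hq₃E : q₃ ∈ E)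
    (hp₁ : d p₁ = edgeVec a y₁) (hq₁ : d q₁ = edgeVec y₁ b) (hp₂ : d p₂ = edgeVec a y₂)
    (hq₂ : d q₂ = edgeVec y₂ b) (hp₃ : d p₃ = edgeVec a y₃) (hq₃ : d q₃ = edgeVec y₃ b)
    (hab : a ≠ b) (ha₁ : a ≠ y₁) (ha₂ : a ≠ y₂) (ha₃ : a ≠ y₃) (hb₁ : b ≠ y₁) (hb₂ : b ≠ y₂)
    (hb₃ : b ≠ y₃) (h12 : y₁ ≠ y₂) (h13 : y₁ ≠ y₃) (h23 : y₂ ≠ y₃) :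
    ∃ F ⊆ E, F.Nonempty ∧ HasKleinFlow d F ∧ ∀ T ⊆ E, T.card = 4 → ∑ e ∈ T, d e = 0 →
      (T ∩ F).Nonempty → T ⊆ F := by
  classical
  obtain ⟨w, hwdef⟩ : ∃ w, w = edgeVec a b := ⟨_, rfl⟩
  have hw : w ≠ 0 := by
    intro h0
    have := edgeVec_apply_left hab
    rw [← hwdef, h0] at this
    simp at this
  have hne : ∀ {x y : β}, d x + d y = w → x ≠ y := by
    rintro x _ hx rfl
    exact hw (hx.symm.trans (ZModModule.add_self _))
  have hw₁ : d p₁ + d q₁ = w := by rw [hp₁, hq₁, edgeVec_add_edgeVec, hwdef]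
  have hw₂ : d p₂ + d q₂ = w := by rw [hp₂, hq₂, edgeVec_add_edgeVec, hwdef]
  have hw₃ : d p₃ + d q₃ = w := by rw [hp₃, hq₃, edgeVec_add_edgeVec, hwdef]
  let F := E.filter fun e => ∃ e' ∈ E, d e + d e' = w
  have hFE : F ⊆ E := Finset.filter_subset _ _
  have hmemF : ∀ {x y : β}, x ∈ E → y ∈ E → d x + d y = w → x ∈ F ∧ y ∈ F := by
    intro x y hx hy hxy
    exact ⟨Finset.mem_filter.2 ⟨hx, y, hy, hxy⟩,
      Finset.mem_filter.2 ⟨hy, x, hx, by rwa [add_comm]⟩⟩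
  refine ⟨F, hFE, ⟨p₁, (hmemF hp₁E hq₁E hw₁).1⟩, ?_, ?_⟩
  · refine .of_pairing hw (a := p₁) (a' := q₁) (b := p₂) (b' := q₂)
      (fun x hx y hy => h.injOn (hFE hx) (hFE hy)) ?_ (hmemF hp₁E hq₁E hw₁).1
      (hmemF hp₁E hq₁E hw₁).2 (hmemF hp₂E hq₂E hw₂).1 (hmemF hp₂E hq₂E hw₂).2 hw₁ hw₂ ?_ ?_
    · intro e he
      obtain ⟨heE, e', he', hee⟩ := Finset.mem_filter.1 he
      exact ⟨e', (hmemF heE he' hee).2, hee⟩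
    · rintro rfl
      have := edgeVec_apply_right ha₁
      rw [← hp₁, hp₂, edgeVec_apply_of_ne ha₁.symm h12] at this
      exact absurd this (by decide)
    · rintro rfl
      have := edgeVec_apply_right ha₁
      rw [← hp₁, hq₂, edgeVec_apply_of_ne h12 hb₁.symm] at this
      exact absurd this (by decide)
  intro T hTE hT4 hT0 hTF
  obtain ⟨e, he⟩ := hTF
  obtain ⟨heT, heF⟩ := Finset.mem_inter.1 he
  obtain ⟨heE, e', he'E, hee⟩ := Finset.mem_filter.1 heF
  by_cases he'T : e' ∈ T
  · have hsub : {e, e'} ⊆ T := by simp [Finset.insert_subset_iff, *]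
    obtain ⟨u, v, huv, hTuv⟩ : ∃ u v, u ≠ v ∧ T \ {e, e'} = {u, v} := by
      rw [← Finset.card_eq_two, Finset.card_sdiff_of_subset hsub, hT4, Finset.card_pair (hne hee)]
    have hu : u ∈ T \ {e, e'} := by simp [hTuv]
    have hv : v ∈ T \ {e, e'} := by simp [hTuv]
    have huvw : d u + d v = w := by
      rw [← Finset.sum_sdiff hsub, Finset.sum_pair (hne hee), hTuv, Finset.sum_pair huv, hee] at hT0
      exact ZModModule.eq_of_add_eq_zero hT0
    have huvF := hmemF (hTE (Finset.mem_sdiff.1 hu).1) (hTE (Finset.mem_sdiff.1 hv).1) huvw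
    rw [← Finset.sdiff_union_of_subset hsub, hTuv]
    have heeF := hmemF heE he'E hee
    simp [Finset.insert_subset_iff, *]
  · exfalso
    have hmeet : ∀ {p q : β}, p ∈ E → q ∈ E → d p + d q = w → p ∈ T ∨ q ∈ T := by
      intro p q hp hq hpq
      by_contra! hnot
      have hep : e ≠ p := by rintro rfl; exact hnot.1 heT
      have heq : e ≠ q := by rintro rfl; exact hnot.2 heT
      have he'p : e' ≠ p := by
        rintro rfl
        exact heq (h.injOn heE hq (add_right_cancel (hee.trans (by rw [add_comm, hpq]))))
      have he'q : e' ≠ q := by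
        rintro rfl
        exact hep (h.injOn heE hp (add_right_cancel (hee.trans hpq.symm)))
      have hcard : ({e, e', p, q} : Finset β).card = 4 := by
        have := hne hee
        have := hne hpq
        rw [Finset.card_insert_of_notMem (by simp [*]), Finset.card_insert_of_notMem (by simp [*]),
          Finset.card_pair (by assumption)]
      have hsum : ∑ x ∈ ({e, e', p, q} : Finset β), d x = 0 := by
        have h1 := hne hee
        have h2 := hne hpq
        rw [Finset.sum_insert (by simp [*]), Finset.sum_insert (by simp [*]), Finset.sum_pair h2,
          ← add_assoc, hee, hpq, ZModModule.add_self]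
      have hev := heven T hTE {e, e', p, q} (by simp [Finset.insert_subset_iff, *]) hT4 hcard hT0
        hsum
      have hone : T ∩ {e, e', p, q} = {e} := by
        ext x
        simp only [Finset.mem_inter, Finset.mem_insert, Finset.mem_singleton]
        constructor
        · rintro ⟨hx, rfl | rfl | rfl | rfl⟩ <;> tauto
        · rintro rfl
          exact ⟨heT, Or.inl rfl⟩
      rw [hone] at hev
      simp at hev
    have hval : ∀ {p q : β} {y z z' : V}, p ∈ E → q ∈ E → d p + d q = w → d p = edgeVec a y →
        d q = edgeVec y b → a ≠ y → b ≠ y → z ≠ a → z ≠ b → z ≠ y → z' ≠ a → z' ≠ b → z' ≠ y →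
        ∃ t ∈ T, d t y = 1 ∧ d t z = 0 ∧ d t z' = 0 := by
      intro p q y z z' hpE hqE hpq hp hq hay hby hza hzb hzy hz'a hz'b hz'y
      rcases hmeet hpE hqE hpq with ht | ht
      · refine ⟨p, ht, ?_⟩
        rw [hp]
        exact ⟨edgeVec_apply_right hay, edgeVec_apply_of_ne hza hzy, edgeVec_apply_of_ne hz'a hz'y⟩
      · refine ⟨q, ht, ?_⟩
        rw [hq]
        exact ⟨edgeVec_apply_left hby.symm, edgeVec_apply_of_ne hzy hzb,
          edgeVec_apply_of_ne hz'y hz'b⟩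
    obtain ⟨t₁, ht₁, t11, t12, t13⟩ := hval hp₁E hq₁E hw₁ hp₁ hq₁ ha₁ hb₁ ha₂.symm hb₂.symm
      h12.symm ha₃.symm hb₃.symm h13.symm
    obtain ⟨t₂, ht₂, t22, t21, t23⟩ := hval hp₂E hq₂E hw₂ hp₂ hq₂ ha₂ hb₂ ha₁.symm hb₁.symm
      h12 ha₃.symm hb₃.symm h23.symm
    obtain ⟨t₃, ht₃, t33, t31, t32⟩ := hval hp₃E hq₃E hw₃ hp₃ hq₃ ha₃ hb₃ ha₁.symm hb₁.symm
      h13 ha₂.symm hb₂.symm h23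
    have n12 : t₁ ≠ t₂ := by rintro rfl; rw [t11] at t21; exact absurd t21 (by decide)
    have n13 : t₁ ≠ t₃ := by rintro rfl; rw [t11] at t31; exact absurd t31 (by decide)
    have n23 : t₂ ≠ t₃ := by rintro rfl; rw [t22] at t32; exact absurd t32 (by decide)
    have hsub : {t₁, t₂, t₃} ⊆ T := by simp [Finset.insert_subset_iff, *]
    have h3 : ({t₁, t₂, t₃} : Finset β).card = 3 :=
      Finset.card_eq_three.2 ⟨t₁, t₂, t₃, n12, n13, n23, rfl⟩
    obtain ⟨t₄, ht₄⟩ : ∃ t₄, T \ {t₁, t₂, t₃} = {t₄} := by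
      rw [← Finset.card_eq_one, Finset.card_sdiff_of_subset hsub, hT4, h3]
    have hmem : t₄ ∈ T \ {t₁, t₂, t₃} := by simp [ht₄]
    obtain ⟨p, q, hpq⟩ := hd t₄ (hTE (Finset.mem_sdiff.1 hmem).1)
    rw [← Finset.sum_sdiff hsub, ht₄, Finset.sum_singleton, Finset.sum_insert (by simp [*]),
      Finset.sum_pair n23, add_comm, hpq] at hT0
    have hz : ∀ z, d t₁ z + (d t₂ z + d t₃ z) + edgeVec p q z = 0 := fun z => by
      simpa using congrArg (fun u : V →₀ ZMod 2 => u z) hT0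
    refine not_edgeVec_apply_three (x := p) (y := q) h12 h13 h23 ?_ ?_ ?_
    · have := hz y₁
      rw [t11, t21, t31] at this
      exact ZMod.eq_one_of_one_add_eq_zero (by simpa using this)
    · have := hz y₂
      rw [t12, t22, t32] at this
      exact ZMod.eq_one_of_one_add_eq_zero (by simpa using this)
    · have := hz y₃
      rw [t13, t23, t33] at this
      exact ZMod.eq_one_of_one_add_eq_zero (by simpa using this)

/-- If any two four-cycles of a triangle-free graph share an even number of edges and it has
a four-cycle `C`, then some non-empty edge set `F` has a nowhere-zero flow and contains every
four-cycle that it meets: `C` itself if it meets no other four-cycle, and a `K_{2,m}` otherwise. -/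
theorem exists_closed_of_even_inter [DecidableEq β] (h : HasGirthFour d E) (hd : IsIncidence d E)
    (heven : ∀ T ⊆ E, ∀ T' ⊆ E, T.card = 4 → T'.card = 4 → ∑ e ∈ T, d e = 0 →
      ∑ e ∈ T', d e = 0 → Even (T ∩ T').card)
    {C : Finset β} (hCE : C ⊆ E) (hC4 : C.card = 4) (hC0 : ∑ e ∈ C, d e = 0) :
    ∃ F ⊆ E, F.Nonempty ∧ HasKleinFlow d F ∧ ∀ T ⊆ E, T.card = 4 → ∑ e ∈ T, d e = 0 →
      (T ∩ F).Nonempty → T ⊆ F := by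
  by_cases hiso : ∀ T ⊆ E, T.card = 4 → ∑ e ∈ T, d e = 0 → (T ∩ C).Nonempty → T ⊆ C
  · exact ⟨C, hCE, Finset.card_pos.1 (by omega), .of_even hC0, hiso⟩
  push Not at hiso
  obtain ⟨T, hTE, hT4, hT0, hTC, hnot⟩ := hiso
  have hcard : (T ∩ C).card = 2 := by
    have h1 : (T ∩ C).card < T.card := Finset.card_lt_card
      ⟨Finset.inter_subset_left, fun hs => hnot (hs.trans Finset.inter_subset_right)⟩
    have h2 := hTC.card_pos
    have h3 := heven T hTE C hCE hT4 hC4 hT0 hC0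
    rw [Nat.even_iff] at h3
    omega
  obtain ⟨e₁, f, hef, hTCeq⟩ := Finset.card_eq_two.1 hcard
  have hin : ∀ {x}, x ∈ T → x ∈ C → x = e₁ ∨ x = f := by
    intro x hx hx'
    have : x ∈ T ∩ C := Finset.mem_inter.2 ⟨hx, hx'⟩
    simpa [hTCeq] using this
  have he₁ : e₁ ∈ T ∩ C := by simp [hTCeq]
  have hf : f ∈ T ∩ C := by simp [hTCeq]
  obtain ⟨he₁T, he₁C⟩ := Finset.mem_inter.1 he₁
  obtain ⟨hfT, hfC⟩ := Finset.mem_inter.1 hf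
  have hsub : {e₁, f} ⊆ T := by simp [Finset.insert_subset_iff, *]
  obtain ⟨g, g', hgg', hTg⟩ : ∃ g g', g ≠ g' ∧ T \ {e₁, f} = {g, g'} := by
    rw [← Finset.card_eq_two, Finset.card_sdiff_of_subset hsub, hT4, Finset.card_pair hef]
  have hsum : d g + d g' = d e₁ + d f := by
    rw [← Finset.sum_sdiff hsub, Finset.sum_pair hef, hTg, Finset.sum_pair hgg'] at hT0
    exact ZModModule.eq_of_add_eq_zero hT0
  have hgT : ∀ x ∈ ({g, g'} : Finset β), x ∈ E ∧ x ∉ C := by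
    intro x hx
    rw [← hTg, Finset.mem_sdiff] at hx
    refine ⟨hTE hx.1, fun hxC => hx.2 ?_⟩
    simpa using hin hx.1 hxC
  obtain ⟨hgE, hgC⟩ := hgT g (by simp)
  obtain ⟨hg'E, hg'C⟩ := hgT g' (by simp)
  obtain ⟨e₂, e₃, e₄, x₁, x₂, x₃, x₄, hCe, hcyc⟩ := h.exists_isFourCycle hd hCE hC4 hC0 he₁C
  have hnotC : ∀ {x}, x ∉ C → x ≠ e₁ ∧ x ≠ e₂ ∧ x ≠ e₃ ∧ x ≠ e₄ := by
    intro x hx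
    simpa [hCe] using hx
  have he₁E : e₁ ∈ E := hCE (by simp [hCe])
  have he₂E : e₂ ∈ E := hCE (by simp [hCe])
  have he₃E : e₃ ∈ E := hCE (by simp [hCe])
  have he₄E : e₄ ∈ E := hCE (by simp [hCe])
  have adjacent : ∀ {e₂ e₃ e₄ : β} {x₁ x₂ x₃ x₄ : V}, IsFourCycle d e₁ e₂ e₃ e₄ x₁ x₂ x₃ x₄ →
      e₂ ∈ E → e₃ ∈ E → e₄ ∈ E → f = e₂ → (∀ {x}, x ∉ C → x ≠ e₁ ∧ x ≠ e₂ ∧ x ≠ e₃ ∧ x ≠ e₄) →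
      ∃ F ⊆ E, F.Nonempty ∧ HasKleinFlow d F ∧ ∀ T ⊆ E, T.card = 4 → ∑ e ∈ T, d e = 0 →
        (T ∩ F).Nonempty → T ⊆ F := by
    rintro e₂ e₃ e₄ x₁ x₂ x₃ x₄ hcyc he₂E he₃E he₄E rfl hnotC
    have hv := hcyc.vertices_nodup
    simp only [List.nodup_cons, List.mem_cons, List.not_mem_nil, or_false, not_or,
      not_false_eq_true, List.nodup_nil, and_true] at hv
    obtain ⟨⟨v12, v13, v14⟩, ⟨v23, v24⟩, v34⟩ := hv
    have hsum' : d g + d g' = edgeVec x₁ x₃ := by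
      rw [hsum, hcyc.edge₁, hcyc.edge₂, edgeVec_add_edgeVec]
    obtain ⟨g, g', hgE, hg'E, y, hy1, hy2, hy3, hy4, hg, hg'⟩ : ∃ g g', g ∈ E ∧ g' ∈ E ∧
        ∃ y, y ≠ x₁ ∧ y ≠ x₂ ∧ y ≠ x₃ ∧ y ≠ x₄ ∧ d g = edgeVec x₁ y ∧ d g' = edgeVec y x₃ := by
      have hat : d g x₁ + d g' x₁ = 1 := by
        rw [← Finsupp.add_apply, hsum', edgeVec_apply_left v13]
      rcases ZMod.eq_one_or_eq_one_of_add_eq_one hat with h1 | h1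
      · exact ⟨g, g', hgE, hg'E, hcyc.exists_path h hd he₁E he₄E hgE hg'E hsum' h1
          (hnotC hgC).1 (hnotC hgC).2.2.2⟩
      · exact ⟨g', g, hg'E, hgE, hcyc.exists_path h hd he₁E he₄E hg'E hgE
          (by rwa [add_comm]) h1 (hnotC hg'C).1 (hnotC hg'C).2.2.2⟩
    exact exists_closed_of_three_paths h hd heven he₁E he₂E he₄E he₃E hgE hg'E hcyc.edge₁ hcyc.edge₂
      (hcyc.edge₄.trans (edgeVec_comm _ _)) (hcyc.edge₃.trans (edgeVec_comm _ _)) hg hg'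
      v13 v12 v14 hy1.symm (Ne.symm v23) v34 hy3.symm v24 hy2.symm hy4.symm
  have hfcases : f = e₁ ∨ f = e₂ ∨ f = e₃ ∨ f = e₄ := by simpa [hCe] using hfC
  rcases hfcases with h1 | h2 | h3 | h4
  · exact absurd h1.symm hef
  · exact adjacent hcyc he₂E he₃E he₄E h2 hnotC
  · exfalso
    subst h3
    have hv := hcyc.vertices_nodup
    simp only [List.nodup_cons, List.mem_cons, List.not_mem_nil, or_false, not_or,
      not_false_eq_true, List.nodup_nil, and_true] at hv
    have hat : d g x₁ + d g' x₁ = 1 := by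
      rw [← Finsupp.add_apply, hsum, Finsupp.add_apply, hcyc.edge₁, hcyc.edge₃,
        edgeVec_apply_left hv.1.1, edgeVec_apply_of_ne hv.1.2.1 hv.1.2.2, add_zero]
    rcases ZMod.eq_one_or_eq_one_of_add_eq_one hat with h1 | h1
    · exact hcyc.opposite_false h hd he₁E he₂E he₄E hgE hg'E hsum h1 (hnotC hgC).1
        (hnotC hgC).2.2.2
    · exact hcyc.opposite_false h hd he₁E he₂E he₄E hg'E hgE (by rw [add_comm, hsum]) h1
        (hnotC hg'C).1 (hnotC hg'C).2.2.2
  · refine adjacent hcyc.reverse he₄E he₃E he₂E h4 fun hx => ?_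
    obtain ⟨a, b, c, d⟩ := hnotC hx
    exact ⟨a, d, c, b⟩

theorem ShortlyCovered.hasKleinFlow (hd : IsIncidence d E) (hcov : ShortlyCovered d E) :
    HasKleinFlow d E := by
  classical
  obtain ⟨n, hn⟩ : ∃ n, E.card = n := ⟨_, rfl⟩
  induction n using Nat.strong_induction_on generalizing d E with
  | _ n ih =>
    subst hn
    have ihlt : ∀ E' : Finset β, E'.card < E.card → ∀ d' : β → V →₀ ZMod 2, IsIncidence d' E' →
        ShortlyCovered d' E' → HasKleinFlow d' E' :=
      fun E' hlt d' h1 h2 => ih E'.card hlt h1 h2 rfl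
    rcases E.eq_empty_or_nonempty with rfl | ⟨e, he⟩
    · exact .of_even (by simp)
    by_cases h : HasGirthFour d E
    swap
    · unfold HasGirthFour at h
      push Not at h
      obtain ⟨S, hSE, hSne, hS0, hS4⟩ := h
      exact .of_contract hSE hS0 (by omega) hd hcov
        (ihlt _ (Finset.card_lt_card (Finset.sdiff_ssubset hSE hSne)))
    have hfour : ∀ T ⊆ E, ∀ x ∈ T, T.card ≤ 4 → ∑ e ∈ T, d e = 0 → T.card = 4 :=
      fun T hT x hx h4 h0 => le_antisymm h4 (h T hT ⟨x, hx⟩ h0)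
    by_cases heven : ∀ T ⊆ E, ∀ T' ⊆ E, T.card = 4 → T'.card = 4 → ∑ e ∈ T, d e = 0 →
        ∑ e ∈ T', d e = 0 → Even (T ∩ T').card
    · obtain ⟨C, hCE, heC, hC4, hC0⟩ := hcov e he
      obtain ⟨F, hFE, hFne, hF, hclosed⟩ :=
        exists_closed_of_even_inter h hd heven hCE (hfour C hCE e heC hC4 hC0) hC0
      refine .union_sdiff hFE hF (ihlt _ (Finset.card_lt_card (Finset.sdiff_ssubset hFE hFne)) d
        (hd.mono Finset.sdiff_subset) fun x hx => ?_)
      obtain ⟨hxE, hxF⟩ := Finset.mem_sdiff.1 hx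
      obtain ⟨T, hTE, hxT, hT4, hT0⟩ := hcov x hxE
      refine ⟨T, fun y hy => Finset.mem_sdiff.2 ⟨hTE hy, fun hyF => hxF ?_⟩, hxT, hT4, hT0⟩
      exact hclosed T hTE (hfour T hTE x hxT hT4 hT0) hT0 ⟨y, Finset.mem_inter.2 ⟨hy, hyF⟩⟩ hxT
    · push Not at heven
      obtain ⟨T₀, hT₀E, C, hCE, hT₀4, hC4, hT₀0, hC0, hodd⟩ := heven
      rw [Nat.not_even_iff_odd] at hodd
      obtain ⟨e₁, he₁⟩ : C.Nonempty := Finset.card_pos.1 (by omega)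
      obtain ⟨e₂, e₃, e₄, x₁, x₂, x₃, x₄, hCe, hcyc⟩ := h.exists_isFourCycle hd hCE hC4 hC0 he₁
      refine .of_fourCycle hd hcov hCE hCe hcyc hT₀E hT₀4.le hT₀0 hodd (ihlt _ ?_)
      have h1 := Finset.card_insert_le e₁ (E \ C)
      have h2 := Finset.card_sdiff_add_card_eq_card hCE
      omega

end EvenIntersections

/-! ### Integer flows on even sets -/

section IntegerFlows

variable {V β : Type*}

open Finsupp in
/-- An even edge set carries an integer flow with all values `1` or `-1`, i.e. it has an Eulerian
orientation. Two edges at a common vertex are replaced by a single edge joining their other ends,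
and a flow through this edge is rerouted along the two. -/
theorem exists_sign_flow_of_even (n : ℕ) (A : Finset β) (hn : A.card = n) (s t : β → V)
    (hA : ∑ e ∈ A, edgeVec (s e) (t e) = 0) :
    ∃ σ : β → ℤ, (∀ e, σ e = 1 ∨ σ e = -1) ∧
      ∑ e ∈ A, σ e • (single (s e) (1 : ℤ) - single (t e) 1) = 0 := by
  classical
  induction n using Nat.strong_induction_on generalizing A s t with
  | _ n ih =>
    rcases A.eq_empty_or_nonempty with rfl | ⟨e, he⟩
    · exact ⟨fun _ => 1, by simp, by simp⟩
    have hlt : (A.erase e).card < n := hn ▸ Finset.card_erase_lt_of_mem he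
    by_cases hloop : s e = t e
    · obtain ⟨σ, hσ, h⟩ := ih _ hlt (A.erase e) rfl s t (by
        rwa [← Finset.add_sum_erase A _ he, hloop, edgeVec_self, zero_add] at hA)
      refine ⟨σ, hσ, ?_⟩
      rw [← Finset.add_sum_erase A _ he, h, hloop, sub_self, smul_zero, zero_add]
    obtain ⟨f, hf, hfe, hft⟩ := exists_next_edge hA he rfl hloop
    have hf' : f ∈ A.erase e := Finset.mem_erase.2 ⟨hfe, hf⟩
    -- The edge `f` is split off at the head of `e`; `e` becomes an edge from `s e` to `z`.
    have split : ∀ (z : V) (c : ℤ), (c = 1 ∨ c = -1) → edgeVec (s f) (t f) = edgeVec (t e) z →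
        single (s f) (1 : ℤ) - single (t f) 1 = c • (single (t e) 1 - single z 1) →
        ∃ σ : β → ℤ, (∀ e, σ e = 1 ∨ σ e = -1) ∧
          ∑ e ∈ A, σ e • (single (s e) (1 : ℤ) - single (t e) 1) = 0 := by
      intro z c hc hz hcz
      have hupd : ∀ x ∈ (A.erase e).erase f, Function.update t f z x = t x := fun x hx =>
        Function.update_of_ne (Finset.mem_erase.1 hx).1 _ _
      have hs : ∀ x ∈ (A.erase e).erase f, Function.update s f (s e) x = s x := fun x hx =>
        Function.update_of_ne (Finset.mem_erase.1 hx).1 _ _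
      obtain ⟨σ, hσ, h⟩ := ih _ hlt (A.erase e) rfl (Function.update s f (s e))
        (Function.update t f z) (by
          rw [← Finset.add_sum_erase A _ he, ← Finset.add_sum_erase _ _ hf', hz, ← add_assoc,
            edgeVec_add_edgeVec] at hA
          rw [← Finset.add_sum_erase _ _ hf', Function.update_self, Function.update_self,
            Finset.sum_congr rfl fun x hx => by rw [hupd x hx, hs x hx], hA])
      rw [← Finset.add_sum_erase _ _ hf', Function.update_self, Function.update_self,
        Finset.sum_congr rfl fun x hx => by rw [hupd x hx, hs x hx]] at h
      refine ⟨fun x => if x = e then σ f else if x = f then c * σ f else σ x, fun x => ?_, ?_⟩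
      · have := hσ f
        have := hσ x
        dsimp only
        split_ifs
        · assumption
        · rcases hc with rfl | rfl <;> omega
        · assumption
      · rw [← Finset.add_sum_erase A _ he, ← Finset.add_sum_erase _ _ hf']
        dsimp only
        rw [if_pos rfl, if_neg hfe,
          if_pos rfl, hcz, smul_smul, mul_right_comm,
          show c * c = 1 by rcases hc with rfl | rfl <;> rfl, one_mul, ← add_assoc, ← smul_add,
          sub_add_sub_cancel]
        rw [← h]
        congr 1
        refine Finset.sum_congr rfl fun x hx => ?_
        obtain ⟨hxf, hx⟩ := Finset.mem_erase.1 hx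
        rw [if_neg (Finset.mem_erase.1 hx).1, if_neg hxf]
    rcases eq_or_eq_of_edgeVec_apply_ne_zero hft with h | h
    · exact split (t f) 1 (Or.inl rfl) (by rw [h]) (by rw [h, one_smul])
    · exact split (s f) (-1) (Or.inr rfl) (by rw [h, edgeVec_comm]) (by rw [h]; simp)

end IntegerFlows

/-! ### From multigraphs to incidence vectors -/

namespace Graph

variable {α β : Type*} {G : Graph α β}

theorem Orientation.isFlow_of_sum_eq_zero [Fintype G.edgeSet] (D : G.Orientation)
    (φ : G.edgeSet → ℤ)
    (h : ∑ e, φ e • (Finsupp.single (D.tail e) (1 : ℤ) - Finsupp.single (D.head e) 1) = 0) :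
    D.IsFlow φ := by
  classical
  intro v _
  have hv := DFunLike.congr_fun h v
  simp only [Finsupp.finsetSum_apply, Finsupp.smul_apply, Finsupp.sub_apply, Finsupp.single_apply,
    smul_sub, Finset.sum_sub_distrib, Finsupp.zero_apply, sub_eq_zero, smul_eq_mul, mul_ite,
    mul_one, mul_zero] at hv
  rw [finsum_mem_def, finsum_mem_def, finsum_eq_sum_of_fintype, finsum_eq_sum_of_fintype]
  simpa only [Set.indicator_apply, Orientation.outEdges, Orientation.inEdges, Set.mem_ofPred_eq]
    using hv

/-- The edge set of a cycle of `G` is an even set with at most `n` elements. -/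
theorem IsCycle.exists_even_finset [Fintype G.edgeSet] (D : G.Orientation) {C : Graph α β} {n : ℕ}
    (hC : C.IsCycle n) (hCG : C ≤ G) (e : G.edgeSet) (he : (e : β) ∈ C.edgeSet) :
    ∃ T : Finset G.edgeSet, e ∈ T ∧ T.card ≤ n ∧
      ∑ x ∈ T, edgeVec (D.tail x) (D.head x) = 0 := by
  classical
  obtain ⟨hn, v, f, -, hf, -, hfC, hlink⟩ := hC
  have : NeZero n := ⟨by omega⟩
  have hlinkG : ∀ i, G.IsLink (f i) (v i) (v (i + 1)) := fun i => (hlink i).mono hCG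
  let F : ZMod n → G.edgeSet := fun i => ⟨f i, (hlinkG i).edge_mem⟩
  have hF : Function.Injective F := fun i j hij => hf (congrArg Subtype.val hij)
  refine ⟨Finset.univ.image F, ?_, ?_, ?_⟩
  · rw [hfC] at he
    obtain ⟨i, hi⟩ := he
    exact Finset.mem_image.2 ⟨i, Finset.mem_univ _, Subtype.ext hi⟩
  · exact Finset.card_image_le.trans (by rw [Finset.card_univ, ZMod.card])
  · have hvec : ∀ i, edgeVec (D.tail (F i)) (D.head (F i)) = edgeVec (v i) (v (i + 1)) := by
      intro i
      rcases (D.isLink_tail_head (F i)).eq_and_eq_or_eq_and_eq (hlinkG i) with ⟨h1, h2⟩ | ⟨h1, h2⟩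
      · rw [h1, h2]
      · rw [h1, h2, edgeVec_comm]
    rw [Finset.sum_image hF.injOn, Finset.sum_congr rfl fun i _ => hvec i]
    unfold edgeVec
    rw [Finset.sum_add_distrib,
      Fintype.sum_equiv (Equiv.addRight (1 : ZMod n))
        (fun i => Finsupp.single (v (i + 1)) (1 : ZMod 2)) (fun i => Finsupp.single (v i) 1)
        fun _ => rfl,
      ZModModule.add_self]

end Graph

/-! ### Klein flows and integer flows -/

open Finsupp in
/-- The two coordinates of a flow with values in `ZMod 2 × ZMod 2` are lifted to integer flows with
values in `{0, 1, -1}`, which are combined with the coefficients `1` and `2`. -/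
theorem HasKleinFlow.exists_int_flow {V β : Type*} [Fintype β] {s t : β → V}
    (h : HasKleinFlow (fun e => edgeVec (s e) (t e)) Finset.univ) :
    ∃ φ : β → ℤ, (∀ e, φ e ≠ 0 ∧ |φ e| < 4) ∧
      ∑ e, φ e • (single (s e) (1 : ℤ) - single (t e) 1) = 0 := by
  classical
  have hlift : ∀ a : β → ZMod 2, ∑ e, a e • edgeVec (s e) (t e) = 0 →
      ∃ σ : β → ℤ, (∀ e, a e = 0 ∧ σ e = 0 ∨ a e ≠ 0 ∧ (σ e = 1 ∨ σ e = -1)) ∧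
        ∑ e, σ e • (single (s e) (1 : ℤ) - single (t e) 1) = 0 := by
    intro a ha
    have htwo : ∀ b : ZMod 2, b ≠ 0 → b = 1 := by decide
    obtain ⟨σ, hσ, hσ0⟩ := exists_sign_flow_of_even _ (Finset.univ.filter fun e => a e ≠ 0) rfl s t
      (by
        rw [Finset.sum_filter]
        refine (Finset.sum_congr rfl fun e _ => ?_).trans ha
        split_ifs with h
        · rw [htwo _ h, one_smul]
        · rw [not_not.1 h, zero_smul])
    refine ⟨fun e => if a e ≠ 0 then σ e else 0, fun e => ?_, ?_⟩
    · by_cases h : a e = 0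
      · simp [h]
      · simpa [h] using hσ e
    · rw [Finset.sum_filter] at hσ0
      simpa only [ite_smul, zero_smul] using hσ0
  obtain ⟨f, f₁, f₂, f₀⟩ := h
  obtain ⟨σ, hσ, hσ0⟩ := hlift _ f₁
  obtain ⟨τ, hτ, hτ0⟩ := hlift _ f₂
  refine ⟨fun e => σ e + 2 * τ e, fun e => ?_, ?_⟩
  · have hne : ¬((f e).1 = 0 ∧ (f e).2 = 0) := fun hz =>
      f₀ e (Finset.mem_univ _) (Prod.ext hz.1 hz.2)
    rw [abs_lt]
    have := hσ e
    have := hτ e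
    dsimp only
    grind
  · simp only [add_smul, mul_smul, Finset.sum_add_distrib, ← Finset.smul_sum, hσ0, hτ0, smul_zero,
      add_zero]

theorem theorem4p3 {α β : Type*} (G : Graph α β)
    (hV : G.vertexSet.Finite) (hE : G.edgeSet.Finite) (hloop : G.Loopless)
    (hcycle : ∀ e ∈ G.edgeSet,
      ∃ (C : Graph α β) (n : ℕ), C ≤ G ∧ C.IsCycle n ∧ n ≤ 4 ∧ e ∈ C.edgeSet) :
    G.HasNowhereZeroFlow 4 := by
  have := hE.fintype
  choose s t hst using fun e : G.edgeSet => Graph.exists_isLink_of_mem_edgeSet e.2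
  let D : G.Orientation := ⟨s, t, hst⟩
  have hcov : ShortlyCovered (fun e => edgeVec (D.tail e) (D.head e)) Finset.univ := by
    intro e _
    obtain ⟨C, n, hCG, hC, hn, he⟩ := hcycle e e.2
    obtain ⟨T, heT, hTn, hT⟩ := hC.exists_even_finset D hCG e he
    exact ⟨T, Finset.subset_univ _, heT, hTn.trans hn, hT⟩
  obtain ⟨φ, hφ, hφ0⟩ := (hcov.hasKleinFlow fun e _ => ⟨_, _, rfl⟩).exists_int_flow
  exact ⟨D, φ, D.isFlow_of_sum_eq_zero φ hφ0, by exact_mod_cast hφ⟩
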